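/- For every $\delta\in(0,1)$ and $\varepsilon_0\in(0,1)$ there is a constant $D>0$, depending only on $\delta$ and $\varepsilon_0$, such that the following holds. Let $X\in\mathbb{R}^{n\times d}$ have rank $\rho$, let $U\in\mathbb{R}^{n\times\rho}$ be any matrix whose columns form an orthonormal basis of the column space of $X$, and let $l_i=\|U_{i*}\|^2/\|U\|_F^2$, $i=1,\dots,n$, be the leverage scores (read as $0$ if $\rho=0$). Let $0<\varepsilon<1$, where $\varepsilon\le\varepsilon_0$ in case $\rho=1$, and let $k$ be any real number with $$k\;\ge\; D\,\frac{\rho\log(\rho/\varepsilon)}{\varepsilon^2}$$ (for $\rho=0$ the right-hand side is read as $0$); in particular $k$ may be chosen equal to the right-hand side, so that $k=O(\rho\log(\rho/\varepsilon)/\varepsilon^2)$. Put $q_i=\min\{1,k\,l_i\}$, and let $S\in\mathbb{R}^{n\times n}$ be the random diagonal matrix with independent diagonal entries such that $S_{ii}=1/\sqrt{q_i}$ with probability $q_i$ and $S_{ii}=0$ otherwise. Then, with probability at least $1-\delta$, the matrix $S$ is an $\varepsilon$-subspace embedding for the column space of $X$, that is, $$(1-\varepsilon)\|X\gamma\|^2\le\|SX\gamma\|^2\le(1+\varepsilon)\|X\gamma\|^2\qquad\text{for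 all }\gamma\in\mathbb{R}^d .$$ Here $\|\cdot\|$ is the Euclidean norm and $\|\cdot\|_F$ the Frobenius norm. -/

import Mathlib

open MeasureTheory

noncomputable section

namespace LeverageSampling

/-- `S` is an `ε`-subspace embedding for the column space of `X`
(the norms are Euclidean). -/
def IsSubspaceEmbedding {m n d : ℕ} (ε : ℝ) (X : Matrix (Fin n) (Fin d) ℝ)
    (S : Matrix (Fin m) (Fin n) ℝ) : Prop :=
  ∀ γ : Fin d → ℝ,
    (1 - ε) * ‖WithLp.toLp 2 (X.mulVec γ)‖ ^ 2 ≤ ‖WithLp.toLp 2 ((S * X).mulVec γ)‖ ^ 2 ∧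
    ‖WithLp.toLp 2 ((S * X).mulVec γ)‖ ^ 2 ≤ (1 + ε) * ‖WithLp.toLp 2 (X.mulVec γ)‖ ^ 2

/-- The columns of `U` form an orthonormal basis of the column space of `X`. -/
def IsOrthonormalColBasis {n d r : ℕ} (X : Matrix (Fin n) (Fin d) ℝ)
    (U : Matrix (Fin n) (Fin r) ℝ) : Prop :=
  Orthonormal ℝ (fun j : Fin r => WithLp.toLp 2 (U.col j)) ∧
    Submodule.span ℝ (Set.range U.col) = Submodule.span ℝ (Set.range X.col)

/-- The leverage score `l_i = ‖U_{i*}‖² / ‖U‖_F²`; the squared Frobenius norm is the sum of the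
squared row norms. -/
def leverageScore {n r : ℕ} (U : Matrix (Fin n) (Fin r) ℝ) (i : Fin n) : ℝ :=
  ‖WithLp.toLp 2 (U.row i)‖ ^ 2 / ∑ i', ‖WithLp.toLp 2 (U.row i')‖ ^ 2

/-- The sampling probability `q_i = min {1, k l_i}`. -/
def samplingProb {n r : ℕ} (U : Matrix (Fin n) (Fin r) ℝ) (k : ℝ) (i : Fin n) : ℝ :=
  min 1 (k * leverageScore U i)

/-- The law of one diagonal entry: `1 / √q` with probability `q`, and `0` otherwise. -/
def entryLaw (q : ℝ) : Measure ℝ :=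
  ENNReal.ofReal q • Measure.dirac (1 / √q) + ENNReal.ofReal (1 - q) • Measure.dirac 0

/-- The joint law of the diagonal `(S_{11}, …, S_{nn})` of the sampling matrix: the entries are
independent, the `i`-th one with law `entryLaw (q i)`. -/
def diagLaw {n : ℕ} (q : Fin n → ℝ) : Measure (Fin n → ℝ) :=
  Measure.pi fun i => entryLaw (q i)

end LeverageSampling

end

open Matrix Finset

/-! Let `u i` be the rows of `U`, so `∑ u i (u i)ᵀ = 1`, and let `Z = ∑ a i • u i (u i)ᵀ` with `a i
= S_ii² - 1`. If `Xγ = Uv`, then `‖SXγ‖² - ‖Xγ‖² = vᵀ Z v`, so it suffices that the spectrum of `Z`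
lies in `[-ε, ε]`, and for this that `tr Z^(2p) ≤ ε^(2p)`. Markov's inequality reduces the theorem
to a bound on `E tr Z^(2p)`.

The moments are bounded by exchangeable pairs. Expand `E tr Z^(m+2) = ∑ E a i (u i)ᵀ Z^(m+1) (u i)`,
resample the `i`-th entry to get `Z'`, and use mean zero and symmetry to reach half the expectation
of `(a - a') uᵀ(Z^(m+1) - Z'^(m+1))u`. Since `Z - Z'` has rank at most one, telescoping and a
Heinz-type inequality bound this by even moments (`mul_dotProduct_pow_sub_pow_le`). With `τ = ρ /
k`, the variance bound `entryWeight_variance_le` closes the recursion, and `E tr Z^(2p) ≤ (5pτ)^p ρ`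
(`sum_prod_mul_trace_pow_le`). Finally `p` is taken of order `log (ρ / δ)`. -/

namespace LeverageSampling

/-! ### Exchangeability under resampling one coordinate. -/

section Resampling

variable {ι κ : Type*} [Fintype ι] [DecidableEq ι] [Fintype κ]

/-- Exchanging the `i`-th coordinate of an independent family with an independent copy leaves the
joint law unchanged. -/
theorem sum_prod_mul_sum_update_comm (w : ι → κ → ℝ) (i : ι) (G : (ι → κ) → (ι → κ) → ℝ) :
    ∑ b : ι → κ, (∏ j, w j (b j)) * ∑ c, w i c * G b (Function.update b i c) =
      ∑ b : ι → κ, (∏ j, w j (b j)) * ∑ c, w i c * G (Function.update b i c) b := by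
  classical
  simp only [Finset.mul_sum]
  rw [← Fintype.sum_prod_type', ← Fintype.sum_prod_type']
  -- Swapping `b i` with the fresh copy `c` is an involution that preserves the weight.
  refine Finset.sum_bij' (fun x _ => (Function.update x.1 i x.2, x.1 i))
    (fun x _ => (Function.update x.1 i x.2, x.1 i)) (by simp) (by simp) (by simp) (by simp) ?_
  rintro ⟨b, c⟩ -
  have h (f : ι → κ) : ∏ j, w j (f j) = w i (f i) * ∏ j ∈ univ.erase i, w j (f j) :=
    (Finset.mul_prod_erase _ _ (mem_univ i)).symm
  have h2 : ∏ j ∈ univ.erase i, w j (Function.update b i c j) =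
      ∏ j ∈ univ.erase i, w j (b j) :=
    Finset.prod_congr rfl fun j hj => by rw [Function.update_of_ne (Finset.ne_of_mem_erase hj)]
  simp only [Function.update_idem, Function.update_eq_self]
  rw [h b, h (Function.update b i c), h2, Function.update_self]
  ring

end Resampling

/-! ### Spectral moments of symmetric matrices. -/

section Spectral

variable {r : Type*} [Fintype r] [DecidableEq r]

theorem exists_orthogonal_diagonal_pow {A : Matrix r r ℝ} (hA : A.IsSymm) :
    ∃ (O : Matrix r r ℝ) (l : r → ℝ), O * Oᵀ = 1 ∧ Oᵀ * O = 1 ∧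
      ∀ m : ℕ, A ^ m = O * diagonal (fun x => l x ^ m) * Oᵀ := by
  have hH : A.IsHermitian := by
    rw [Matrix.IsHermitian, Matrix.conjTranspose_eq_transpose_of_trivial]; exact hA
  have h1 : (hH.eigenvectorUnitary : Matrix r r ℝ) *
      (hH.eigenvectorUnitary : Matrix r r ℝ)ᵀ = 1 := by
    have := Unitary.mul_star_self_of_mem hH.eigenvectorUnitary.2
    rwa [Matrix.star_eq_conjTranspose, Matrix.conjTranspose_eq_transpose_of_trivial] at this
  have h2 : (hH.eigenvectorUnitary : Matrix r r ℝ)ᵀ *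
      (hH.eigenvectorUnitary : Matrix r r ℝ) = 1 := by
    have := Unitary.star_mul_self_of_mem hH.eigenvectorUnitary.2
    rwa [Matrix.star_eq_conjTranspose, Matrix.conjTranspose_eq_transpose_of_trivial] at this
  have h3 := hH.spectral_theorem
  rw [Unitary.conjStarAlgAut_apply, Matrix.star_eq_conjTranspose,
    Matrix.conjTranspose_eq_transpose_of_trivial] at h3
  generalize (hH.eigenvectorUnitary : Matrix r r ℝ) = O at *
  refine ⟨O, hH.eigenvalues, h1, h2, fun m => ?_⟩
  induction m with
  | zero => simp [h1]
  | succ m ih =>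
    have h4 : A = O * diagonal hH.eigenvalues * Oᵀ := h3
    calc A ^ (m + 1) = A ^ m * A := pow_succ _ _
      _ = (O * diagonal (fun x => hH.eigenvalues x ^ m) * Oᵀ) *
          (O * diagonal hH.eigenvalues * Oᵀ) := by rw [ih]; congr 1
      _ = O * diagonal (fun x => hH.eigenvalues x ^ m) * (Oᵀ * O) *
          diagonal hH.eigenvalues * Oᵀ := by simp only [Matrix.mul_assoc]
      _ = _ := by
        rw [h2, Matrix.mul_one, Matrix.mul_assoc O, Matrix.diagonal_mul_diagonal]
        simp only [pow_succ]

/-- The moments `uᵀ A ^ m u` of a symmetric matrix are those of a positive measure of mass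
`uᵀ u` on the spectrum. -/
theorem exists_spectral_measure {A : Matrix r r ℝ} (hA : A.IsSymm) :
    ∃ l : r → ℝ, (∀ m : ℕ, (A ^ m).trace = ∑ x, l x ^ m) ∧
      ∀ u : r → ℝ, ∃ c : r → ℝ, (∀ x, 0 ≤ c x) ∧
        ∀ m : ℕ, u ⬝ᵥ (A ^ m *ᵥ u) = ∑ x, c x * l x ^ m := by
  obtain ⟨O, l, h1, h2, h⟩ := exists_orthogonal_diagonal_pow hA
  refine ⟨l, fun m => ?_, fun u => ⟨fun x => ((Oᵀ *ᵥ u) x) ^ 2, fun x => sq_nonneg _,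
    fun m => ?_⟩⟩
  · rw [h, Matrix.trace_mul_comm, ← Matrix.mul_assoc, h2, Matrix.one_mul, Matrix.trace_diagonal]
  · rw [h, ← Matrix.mulVec_mulVec, ← Matrix.mulVec_mulVec, Matrix.dotProduct_mulVec,
      ← Matrix.mulVec_transpose]
    simp only [dotProduct, Matrix.mulVec_diagonal]
    exact Finset.sum_congr rfl fun x _ => by ring

end Spectral

/-! ### Heinz-type inequalities and rank-one perturbation. -/

section Heinz

/-- The powers `j` and `m - j` order `|x|` and `|y|` the same way, so the product of their
differences is nonnegative; evenness of `m` removes the absolute values. -/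
theorem pow_mul_pow_add_le (x y : ℝ) {j m : ℕ} (hm : Even m) (hj : j ≤ m) :
    x ^ j * y ^ (m - j) + x ^ (m - j) * y ^ j ≤ x ^ m + y ^ m := by
  have h1 : x ^ j * y ^ (m - j) + x ^ (m - j) * y ^ j ≤
      |x| ^ j * |y| ^ (m - j) + |x| ^ (m - j) * |y| ^ j := by
    simp only [← abs_pow, ← abs_mul]
    exact add_le_add (le_abs_self _) (le_abs_self _)
  have h2 : 0 ≤ (|x| ^ j - |y| ^ j) * (|x| ^ (m - j) - |y| ^ (m - j)) := by
    rcases le_total |x| |y| with h | h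
    · exact mul_nonneg_of_nonpos_of_nonpos
        (sub_nonpos.2 (pow_le_pow_left₀ (abs_nonneg _) h _))
        (sub_nonpos.2 (pow_le_pow_left₀ (abs_nonneg _) h _))
    · exact mul_nonneg (sub_nonneg.2 (pow_le_pow_left₀ (abs_nonneg _) h _))
        (sub_nonneg.2 (pow_le_pow_left₀ (abs_nonneg _) h _))
  have h3 (z : ℝ) : |z| ^ j * |z| ^ (m - j) = z ^ m := by
    rw [← pow_add, Nat.add_sub_cancel' hj, hm.pow_abs]
  linarith [h3 x, h3 y]

theorem sum_pow_mul_pow_le (x y : ℝ) {m : ℕ} (hm : Even m) :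
    ∑ j ∈ range (m + 1), x ^ j * y ^ (m - j) ≤ (m + 1) / 2 * (x ^ m + y ^ m) := by
  have h1 : ∑ j ∈ range (m + 1), x ^ (m - j) * y ^ j =
      ∑ j ∈ range (m + 1), x ^ j * y ^ (m - j) := by
    rw [← Finset.sum_range_reflect]
    refine Finset.sum_congr rfl fun j hj => ?_
    have : j ≤ m := Nat.lt_succ_iff.1 (mem_range.1 hj)
    simp [Nat.sub_sub_self this]
  have h2 : ∑ j ∈ range (m + 1), (x ^ j * y ^ (m - j) + x ^ (m - j) * y ^ j) ≤
      ∑ _j ∈ range (m + 1), (x ^ m + y ^ m) :=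
    Finset.sum_le_sum fun j hj =>
      pow_mul_pow_add_le x y hm (Nat.lt_succ_iff.1 (mem_range.1 hj))
  rw [Finset.sum_add_distrib, h1, Finset.sum_const, card_range, nsmul_eq_mul] at h2
  push_cast at h2
  linarith

variable {r : Type*} [Fintype r] [DecidableEq r]

/-- Both moment sequences come from positive measures of mass `u ⬝ᵥ u`, so the scalar inequality can
be integrated against their product, although `A` and `B` need not commute. -/
theorem sum_moment_mul_moment_le {A B : Matrix r r ℝ} (hA : A.IsSymm) (hB : B.IsSymm)
    (u : r → ℝ) {m : ℕ} (hm : Even m) :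
    ∑ j ∈ range (m + 1), (u ⬝ᵥ (A ^ j *ᵥ u)) * (u ⬝ᵥ (B ^ (m - j) *ᵥ u)) ≤
      (m + 1) / 2 * (u ⬝ᵥ u) * (u ⬝ᵥ (A ^ m *ᵥ u) + u ⬝ᵥ (B ^ m *ᵥ u)) := by
  obtain ⟨l, -, hl⟩ := exists_spectral_measure hA
  obtain ⟨c, hc, hcm⟩ := hl u
  obtain ⟨l', -, hl'⟩ := exists_spectral_measure hB
  obtain ⟨c', hc', hcm'⟩ := hl' u
  have h0 : u ⬝ᵥ u = ∑ x, c x := by simpa using hcm 0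
  have h0' : u ⬝ᵥ u = ∑ x, c' x := by simpa using hcm' 0
  calc ∑ j ∈ range (m + 1), (u ⬝ᵥ (A ^ j *ᵥ u)) * (u ⬝ᵥ (B ^ (m - j) *ᵥ u))
      = ∑ x, ∑ y, c x * c' y * ∑ j ∈ range (m + 1), l x ^ j * l' y ^ (m - j) := by
        simp only [hcm, hcm', Finset.sum_mul_sum]
        simp only [Finset.mul_sum]
        rw [Finset.sum_comm]
        refine Finset.sum_congr rfl fun x _ => ?_
        rw [Finset.sum_comm]
        exact Finset.sum_congr rfl fun y _ => Finset.sum_congr rfl fun j _ => by ring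
    _ ≤ ∑ x, ∑ y, c x * c' y * ((m + 1) / 2 * (l x ^ m + l' y ^ m)) := by
        gcongr with x _ y _
        · exact mul_nonneg (hc x) (hc' y)
        · exact sum_pow_mul_pow_le _ _ hm
    _ = (m + 1) / 2 * ((∑ x, c x * l x ^ m) * (∑ y, c' y) +
          (∑ x, c x) * (∑ y, c' y * l' y ^ m)) := by
        simp only [Finset.sum_mul_sum, ← Finset.sum_add_distrib]
        simp only [Finset.mul_sum]
        exact Finset.sum_congr rfl fun x _ => Finset.sum_congr rfl fun y _ => by ring
    _ = _ := by rw [hcm, hcm', ← h0, ← h0']; ring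

/-- A rank-one perturbation bound for odd powers of symmetric matrices. -/
theorem mul_dotProduct_pow_sub_pow_le {A B : Matrix r r ℝ} (hA : A.IsSymm) (hB : B.IsSymm)
    (u : r → ℝ) (t : ℝ) (hAB : A - B = t • vecMulVec u u) {m : ℕ} (hm : Even m) :
    t * (u ⬝ᵥ (A ^ (m + 1) *ᵥ u) - u ⬝ᵥ (B ^ (m + 1) *ᵥ u)) ≤
      t ^ 2 * ((m + 1) / 2 * (u ⬝ᵥ u) * (u ⬝ᵥ (A ^ m *ᵥ u) + u ⬝ᵥ (B ^ m *ᵥ u))) := by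
  -- Noncommutative telescoping; the rank-one factor `A - B` splits each term into a product of two
  -- scalar moments.
  have key (N : ℕ) : u ⬝ᵥ (A ^ N *ᵥ u) - u ⬝ᵥ (B ^ N *ᵥ u) =
      t * ∑ j ∈ range N, (u ⬝ᵥ (A ^ j *ᵥ u)) * (u ⬝ᵥ (B ^ (N - 1 - j) *ᵥ u)) := by
    have tele : A ^ N - B ^ N = ∑ j ∈ range N, A ^ j * (A - B) * B ^ (N - 1 - j) := by
      induction N with
      | zero => simp
      | succ N ih =>
        rw [Finset.sum_range_succ]
        have : ∑ j ∈ range N, A ^ j * (A - B) * B ^ (N + 1 - 1 - j) =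
            (∑ j ∈ range N, A ^ j * (A - B) * B ^ (N - 1 - j)) * B := by
          rw [Finset.sum_mul]
          refine Finset.sum_congr rfl fun j hj => ?_
          have : j < N := mem_range.1 hj
          rw [Matrix.mul_assoc _ _ B, ← pow_succ]
          congr 2; omega
        rw [this, ← ih]
        simp only [Nat.add_sub_cancel, Nat.sub_self, pow_zero, Matrix.mul_one, pow_succ]
        noncomm_ring
    rw [← dotProduct_sub, ← Matrix.sub_mulVec, tele, Matrix.sum_mulVec, dotProduct_sum,
      Finset.mul_sum]
    refine Finset.sum_congr rfl fun j _ => ?_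
    rw [hAB, ← Matrix.mulVec_mulVec, ← Matrix.mulVec_mulVec, Matrix.smul_mulVec,
      Matrix.vecMulVec_mulVec, Matrix.mulVec_smul]
    simp only [Matrix.mulVec_smul, dotProduct_smul, smul_eq_mul, op_smul_eq_smul]
    ring
  rw [key, ← mul_assoc, ← sq]
  exact mul_le_mul_of_nonneg_left (sum_moment_mul_moment_le hA hB u hm) (sq_nonneg t)

end Heinz

/-! ### Random sums of rank-one matrices. -/

section RankOneSum

variable {ι κ r : Type*} [Fintype ι]

/-- The matrix `∑ i, a i (b i) • u i (u i)ᵀ` determined by the outcomes `b`. -/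
def rankOneSum (a : ι → κ → ℝ) (u : ι → r → ℝ) (b : ι → κ) : Matrix r r ℝ :=
  ∑ i, a i (b i) • vecMulVec (u i) (u i)

theorem rankOneSum_isSymm (a : ι → κ → ℝ) (u : ι → r → ℝ) (b : ι → κ) :
    (rankOneSum a u b).IsSymm := by
  simp [rankOneSum, Matrix.IsSymm, Matrix.transpose_sum, Matrix.transpose_vecMulVec]

theorem rankOneSum_sub_update [DecidableEq ι] (a : ι → κ → ℝ) (u : ι → r → ℝ) (b : ι → κ) (i : ι)
    (c : κ) :
    rankOneSum a u b - rankOneSum a u (Function.update b i c) =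
      (a i (b i) - a i c) • vecMulVec (u i) (u i) := by
  rw [rankOneSum, rankOneSum, ← Finset.sum_sub_distrib, Finset.sum_eq_single i]
  · simp [sub_smul]
  · intro j _ hj
    simp [Function.update_of_ne hj]
  · simp

theorem sum_mul_dotProduct_eq_trace [Fintype r] (a : ι → κ → ℝ) (u : ι → r → ℝ) (b : ι → κ)
    (A : Matrix r r ℝ) :
    ∑ i, a i (b i) * (u i ⬝ᵥ (A *ᵥ u i)) = (rankOneSum a u b * A).trace := by
  rw [rankOneSum, Finset.sum_mul, Matrix.trace_sum]
  refine Finset.sum_congr rfl fun i _ => ?_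
  rw [Matrix.smul_mul, Matrix.trace_smul, smul_eq_mul, Matrix.vecMulVec_mul,
    Matrix.trace_vecMulVec, Matrix.dotProduct_mulVec, dotProduct_comm]

end RankOneSum

/-! ### The trace moment recursion. -/

section Moments

variable {ι κ r : Type*} [Fintype ι] [DecidableEq ι] [Fintype κ] [Fintype r] [DecidableEq r]

theorem dotProduct_even_pow_mulVec_nonneg {A : Matrix r r ℝ} (hA : A.IsSymm) (u : r → ℝ)
    {m : ℕ} (hm : Even m) : 0 ≤ u ⬝ᵥ (A ^ m *ᵥ u) := by
  obtain ⟨l, -, hl⟩ := exists_spectral_measure hA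
  obtain ⟨c, hc, hcm⟩ := hl u
  rw [hcm]
  exact Finset.sum_nonneg fun x _ => mul_nonneg (hc x) (hm.pow_nonneg _)

theorem trace_even_pow_nonneg {A : Matrix r r ℝ} (hA : A.IsSymm) {m : ℕ} (hm : Even m) :
    0 ≤ (A ^ m).trace := by
  obtain ⟨l, hl, -⟩ := exists_spectral_measure hA
  rw [hl]
  exact Finset.sum_nonneg fun x _ => hm.pow_nonneg _

/-- On each eigenvalue `z` this is `z ^ m * (z - 1) ^ 2 ≥ 0`. -/
theorem trace_odd_pow_le {A : Matrix r r ℝ} (hA : A.IsSymm) {m : ℕ} (hm : Even m) :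
    (A ^ (m + 1)).trace ≤ 1 / 2 * ((A ^ (m + 2)).trace + (A ^ m).trace) := by
  obtain ⟨l, hl, -⟩ := exists_spectral_measure hA
  rw [hl, hl, hl, ← Finset.sum_add_distrib, Finset.mul_sum]
  refine Finset.sum_le_sum fun x _ => ?_
  have := mul_nonneg (hm.pow_nonneg (l x)) (sq_nonneg (l x - 1))
  linear_combination this / 2

variable {w a : ι → κ → ℝ} {u : ι → r → ℝ}

/-- Replacing the `i`-th summand by an independent copy bounds its correlation with an odd power
of the random matrix. -/
theorem sum_prod_mul_correlation_le (hw : ∀ i x, 0 ≤ w i x) (hw1 : ∀ i, ∑ x, w i x = 1)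
    (i : ι) (hmean : (∑ x, w i x * a i x) • u i = 0) {m : ℕ} (hm : Even m) :
    ∑ b : ι → κ, (∏ j, w j (b j)) *
        (a i (b i) * (u i ⬝ᵥ (rankOneSum a u b ^ (m + 1) *ᵥ u i))) ≤
      (m + 1) / 2 * ∑ b : ι → κ, (∏ j, w j (b j)) *
        ((∑ c, w i c * (a i (b i) - a i c) ^ 2) * (u i ⬝ᵥ u i) *
          (u i ⬝ᵥ (rankOneSum a u b ^ m *ᵥ u i))) := by
  set f : ℕ → (ι → κ) → ℝ := fun N b => u i ⬝ᵥ (rankOneSum a u b ^ N *ᵥ u i) with hf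
  have hzero (b : ι → κ) : (∑ c, w i c * a i c) * f (m + 1) b = 0 := by
    have : (∑ c, w i c * a i c) * f (m + 1) b =
        ((∑ c, w i c * a i c) • u i) ⬝ᵥ (rankOneSum a u b ^ (m + 1) *ᵥ u i) := by
      rw [smul_dotProduct, smul_eq_mul]
    rw [this, hmean, zero_dotProduct]
  -- By mean zero, an independent copy of the coefficient can be subtracted for free.
  have e1 : ∑ b : ι → κ, (∏ j, w j (b j)) * (a i (b i) * f (m + 1) b) =
      ∑ b : ι → κ, (∏ j, w j (b j)) * ∑ c, w i c * ((a i (b i) -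
        a i (Function.update b i c i)) * f (m + 1) b) := by
    refine Finset.sum_congr rfl fun b _ => ?_
    congr 1
    have : ∑ c, w i c * ((a i (b i) - a i (Function.update b i c i)) * f (m + 1) b) =
        (∑ c, w i c) * (a i (b i) * f (m + 1) b) - (∑ c, w i c * a i c) * f (m + 1) b := by
      rw [Finset.sum_mul, Finset.sum_mul, ← Finset.sum_sub_distrib]
      refine Finset.sum_congr rfl fun c _ => ?_
      rw [Function.update_self]; ring
    rw [this, hw1, hzero]; ring
  have e2 := sum_prod_mul_sum_update_comm w i
    (fun b b' => (a i (b i) - a i (b' i)) * f (m + 1) b)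
  have e3 := sum_prod_mul_sum_update_comm w i
    (fun b b' => (a i (b i) - a i (b' i)) ^ 2 * f m b)
  have ineq (b : ι → κ) : (∏ j, w j (b j)) * ∑ c, w i c * ((a i (b i) -
        a i (Function.update b i c i)) * f (m + 1) b) +
      (∏ j, w j (b j)) * ∑ c, w i c * ((a i (Function.update b i c i) - a i (b i)) *
        f (m + 1) (Function.update b i c)) ≤
      (m + 1) / 2 * (u i ⬝ᵥ u i) *
      ((∏ j, w j (b j)) * ∑ c, w i c * ((a i (b i) - a i (Function.update b i c i)) ^ 2 * f m b) +
      (∏ j, w j (b j)) * ∑ c, w i c * ((a i (Function.update b i c i) - a i (b i)) ^ 2 *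
        f m (Function.update b i c))) := by
    rw [← mul_add, ← mul_add, ← Finset.sum_add_distrib, ← Finset.sum_add_distrib, mul_left_comm,
      Finset.mul_sum univ _ ((m + 1 : ℝ) / 2 * (u i ⬝ᵥ u i))]
    refine mul_le_mul_of_nonneg_left (Finset.sum_le_sum fun c _ => ?_)
      (Finset.prod_nonneg fun j _ => hw _ _)
    have h := mul_dotProduct_pow_sub_pow_le (rankOneSum_isSymm a u b)
      (rankOneSum_isSymm a u (Function.update b i c)) (u i) _ (rankOneSum_sub_update a u b i c) hm
    have h' := mul_le_mul_of_nonneg_left h (hw i c)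
    rw [Function.update_self]
    simp only [hf]
    linear_combination h'
  have total := Finset.sum_le_sum fun b (_ : b ∈ univ) => ineq b
  -- By exchangeability the two halves on each side of `ineq` have equal sums.
  rw [← Finset.mul_sum, Finset.sum_add_distrib, Finset.sum_add_distrib, ← e2, ← e3, ← e1] at total
  have e4 : ∑ b : ι → κ, (∏ j, w j (b j)) *
        ((∑ c, w i c * (a i (b i) - a i c) ^ 2) * (u i ⬝ᵥ u i) * f m b) =
      (u i ⬝ᵥ u i) * ∑ b : ι → κ, (∏ j, w j (b j)) * ∑ c, w i c *
        ((a i (b i) - a i (Function.update b i c i)) ^ 2 * f m b) := by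
    rw [Finset.mul_sum]
    refine Finset.sum_congr rfl fun b _ => ?_
    simp only [Function.update_self, ← mul_assoc, ← Finset.sum_mul]
    ring
  rw [e4]
  linear_combination total / 2

/-- The recursive moment inequality. -/
theorem sum_prod_mul_trace_pow_add_two_le (hw : ∀ i x, 0 ≤ w i x) (hw1 : ∀ i, ∑ x, w i x = 1)
    (hmean : ∀ i, (∑ x, w i x * a i x) • u i = 0)
    (hu : ∑ i, vecMulVec (u i) (u i) = 1) {τ : ℝ}
    (hvar : ∀ i x, 0 < w i x →
      (∑ c, w i c * (a i x - a i c) ^ 2) * (u i ⬝ᵥ u i) ≤ τ * (a i x + 2))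
    {m : ℕ} (hm : Even m) :
    ∑ b : ι → κ, (∏ j, w j (b j)) * (rankOneSum a u b ^ (m + 2)).trace ≤
      (m + 1) / 2 * τ * ∑ b : ι → κ, (∏ j, w j (b j)) *
        ((rankOneSum a u b ^ (m + 1)).trace + 2 * (rankOneSum a u b ^ m).trace) := by
  have h1 : ∑ b : ι → κ, (∏ j, w j (b j)) * (rankOneSum a u b ^ (m + 2)).trace =
      ∑ i, ∑ b : ι → κ, (∏ j, w j (b j)) *
        (a i (b i) * (u i ⬝ᵥ (rankOneSum a u b ^ (m + 1) *ᵥ u i))) := by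
    rw [Finset.sum_comm]
    refine Finset.sum_congr rfl fun b _ => ?_
    rw [← Finset.mul_sum, sum_mul_dotProduct_eq_trace, ← pow_succ']
  have htr (A : Matrix r r ℝ) : A.trace = ∑ i, u i ⬝ᵥ (A *ᵥ u i) := by
    have := sum_mul_dotProduct_eq_trace (fun (_ : ι) (_ : Unit) => (1 : ℝ)) u (fun _ => ()) A
    simpa [rankOneSum, hu] using this.symm
  rw [h1]
  refine (Finset.sum_le_sum fun i _ =>
    sum_prod_mul_correlation_le hw hw1 i (hmean i) hm).trans ?_
  rw [← Finset.mul_sum, mul_assoc]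
  refine mul_le_mul_of_nonneg_left ?_ (by positivity)
  rw [Finset.sum_comm, Finset.mul_sum]
  refine Finset.sum_le_sum fun b _ => ?_
  rw [← Finset.mul_sum, mul_left_comm]
  have hP : 0 ≤ ∏ j, w j (b j) := Finset.prod_nonneg fun j _ => hw _ _
  rcases hP.eq_or_lt with h0 | hpos
  · rw [← h0]; simp
  refine mul_le_mul_of_nonneg_left ?_ hP
  rw [pow_succ', ← sum_mul_dotProduct_eq_trace, htr, Finset.mul_sum univ _ (2 : ℝ),
    ← Finset.sum_add_distrib, Finset.mul_sum]
  refine Finset.sum_le_sum fun i _ => ?_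
  have hi : 0 < w i (b i) := (hw _ _).lt_of_ne' fun h =>
    hpos.ne' (Finset.prod_eq_zero (mem_univ i) h)
  have := mul_le_mul_of_nonneg_right (hvar i (b i) hi)
    (dotProduct_even_pow_mulVec_nonneg (rankOneSum_isSymm a u b) (u i) hm)
  linear_combination this

/-- Eliminating the odd moment gives `E (m+2) ≤ pτ (E (m+2) / 2 + 5/2 E m)`; as `pτ ≤ 1`, the first
term is absorbed on the left, so each step costs a factor `5pτ`. -/
theorem sum_prod_mul_trace_pow_le (hw : ∀ i x, 0 ≤ w i x) (hw1 : ∀ i, ∑ x, w i x = 1)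
    (hmean : ∀ i, (∑ x, w i x * a i x) • u i = 0)
    (hu : ∑ i, vecMulVec (u i) (u i) = 1) {τ : ℝ} (hτ : 0 ≤ τ)
    (hvar : ∀ i x, 0 < w i x →
      (∑ c, w i c * (a i x - a i c) ^ 2) * (u i ⬝ᵥ u i) ≤ τ * (a i x + 2))
    (p : ℕ) (hp : p * τ ≤ 1) {s : ℕ} (hs : s ≤ p) :
    ∑ b : ι → κ, (∏ j, w j (b j)) * (rankOneSum a u b ^ (2 * s)).trace ≤
      (5 * p * τ) ^ s * Fintype.card r := by
  induction s with
  | zero =>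
    simp only [mul_zero, pow_zero, Matrix.trace_one, ← Finset.sum_mul, one_mul]
    rw [← Fintype.piFinset_univ, ← Finset.prod_univ_sum]
    simp [hw1]
  | succ s ih =>
    have ih := ih (by omega)
    have hm : Even (2 * s) := even_two_mul s
    have hrec := sum_prod_mul_trace_pow_add_two_le hw hw1 hmean hu hvar hm
    set E : ℕ → ℝ := fun N => ∑ b : ι → κ, (∏ j, w j (b j)) * (rankOneSum a u b ^ N).trace with hE
    have hmid : ∑ b : ι → κ, (∏ j, w j (b j)) *
        ((rankOneSum a u b ^ (2 * s + 1)).trace + 2 * (rankOneSum a u b ^ (2 * s)).trace) ≤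
        1 / 2 * E (2 * s + 2) + 5 / 2 * E (2 * s) := by
      simp only [hE]
      rw [Finset.mul_sum, Finset.mul_sum, ← Finset.sum_add_distrib]
      refine Finset.sum_le_sum fun b _ => ?_
      have := mul_le_mul_of_nonneg_left (trace_odd_pow_le (rankOneSum_isSymm a u b) hm)
        (Finset.prod_nonneg fun j (_ : j ∈ univ) => hw j (b j))
      linear_combination this
    have hEnn (N : ℕ) (hN : Even N) : 0 ≤ E N :=
      Finset.sum_nonneg fun b _ => mul_nonneg (Finset.prod_nonneg fun j _ => hw j (b j))
        (trace_even_pow_nonneg (rankOneSum_isSymm a u b) hN)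
    have hsp : (s : ℝ) + 1 ≤ p := by exact_mod_cast hs
    have hcoef : ((2 * s : ℕ) + 1 : ℝ) / 2 * τ ≤ p * τ := by
      push_cast
      exact mul_le_mul_of_nonneg_right (by linarith) hτ
    have h2 : E (2 * s + 2) ≤ p * τ * (1 / 2 * E (2 * s + 2) + 5 / 2 * E (2 * s)) := by
      refine hrec.trans ((mul_le_mul_of_nonneg_left hmid (by positivity)).trans
        (mul_le_mul_of_nonneg_right hcoef ?_))
      have := hEnn (2 * s) hm
      have := hEnn (2 * s + 2) (hm.add even_two)
      positivity
    have h3 : p * τ * E (2 * s + 2) ≤ E (2 * s + 2) :=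
      mul_le_of_le_one_left (hEnn _ (hm.add even_two)) hp
    have h4 : E (2 * s + 2) ≤ 5 * p * τ * E (2 * s) := by linarith
    calc E (2 * (s + 1)) ≤ 5 * p * τ * E (2 * s) := h4
      _ ≤ 5 * p * τ * ((5 * p * τ) ^ s * Fintype.card r) :=
        mul_le_mul_of_nonneg_left ih (by positivity)
      _ = _ := by ring

/-- Each eigenvalue to the power `2p` is at most the trace, a sum of nonnegative terms. -/
theorem abs_dotProduct_mulVec_le_of_trace_pow_le {A : Matrix r r ℝ} (hA : A.IsSymm) {p : ℕ}
    (hp : p ≠ 0) {ε : ℝ} (hε : 0 ≤ ε) (h : (A ^ (2 * p)).trace ≤ ε ^ (2 * p)) (v : r → ℝ) :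
    |v ⬝ᵥ (A *ᵥ v)| ≤ ε * (v ⬝ᵥ v) := by
  obtain ⟨l, hl, hlu⟩ := exists_spectral_measure hA
  obtain ⟨c, hc, hcm⟩ := hlu v
  have h0 : v ⬝ᵥ v = ∑ x, c x := by simpa using hcm 0
  have h1 : v ⬝ᵥ (A *ᵥ v) = ∑ x, c x * l x := by simpa using hcm 1
  have hb (x : r) : |l x| ≤ ε := by
    refine le_of_pow_le_pow_left₀ (n := 2 * p) (by omega) hε ?_
    rw [(even_two_mul p).pow_abs]
    refine le_trans ?_ h
    rw [hl]
    exact Finset.single_le_sum (f := fun x => l x ^ (2 * p))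
      (fun y _ => (even_two_mul p).pow_nonneg _) (mem_univ x)
  rw [h0, h1, Finset.mul_sum]
  refine (Finset.abs_sum_le_sum_abs _ _).trans (Finset.sum_le_sum fun x _ => ?_)
  rw [abs_mul, abs_of_nonneg (hc x), mul_comm]
  exact mul_le_mul_of_nonneg_right (hb x) (hc x)

end Moments

/-! ### The law of the diagonal as a finite Bernoulli model. -/

section Law

/-- The value of a diagonal entry, as a function of whether the row is sampled. -/
noncomputable def entryValue (q : ℝ) (x : Bool) : ℝ := if x then 1 / √q else 0

/-- The probability that the row is, or is not, sampled. -/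
def entryWeight (q : ℝ) (x : Bool) : ℝ := if x then q else 1 - q

/-- The law of the indicator of sampling a row. -/
noncomputable def bernoulliLaw (q : ℝ) : Measure Bool :=
  ENNReal.ofReal q • Measure.dirac true + ENNReal.ofReal (1 - q) • Measure.dirac false

theorem entryWeight_nonneg {q : ℝ} (h0 : 0 ≤ q) (h1 : q ≤ 1) (x : Bool) :
    0 ≤ entryWeight q x := by
  cases x <;> simp [entryWeight, h0, h1]

theorem sum_entryWeight (q : ℝ) : ∑ x, entryWeight q x = 1 := by
  simp [entryWeight]

theorem isProbabilityMeasure_bernoulliLaw {q : ℝ} (h0 : 0 ≤ q) (h1 : q ≤ 1) :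
    IsProbabilityMeasure (bernoulliLaw q) := by
  constructor
  simp [bernoulliLaw, ← ENNReal.ofReal_add h0 (sub_nonneg.2 h1)]

theorem bernoulliLaw_real_singleton {q : ℝ} (h0 : 0 ≤ q) (h1 : q ≤ 1) (x : Bool) :
    (bernoulliLaw q).real {x} = entryWeight q x := by
  cases x <;> simp [bernoulliLaw, entryWeight, Measure.real, h0, h1]

theorem map_bernoulliLaw (q : ℝ) : (bernoulliLaw q).map (entryValue q) = entryLaw q := by
  have hm : Measurable (entryValue q) := measurable_of_finite _
  rw [bernoulliLaw, entryLaw, Measure.map_add _ _ hm, Measure.map_smul, Measure.map_smul,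
    Measure.map_dirac' hm, Measure.map_dirac' hm]
  simp [entryValue]

/-- Markov's inequality for the law of the diagonal, with the expectation written as a sum over
the sampled sets of rows. -/
theorem one_sub_le_diagLaw_real {n : ℕ} {q : Fin n → ℝ} (h0 : ∀ i, 0 ≤ q i) (h1 : ∀ i, q i ≤ 1)
    {A : Set (Fin n → ℝ)} {g : (Fin n → Bool) → ℝ} (hg : ∀ b, 0 ≤ g b) {t δ : ℝ} (ht : 0 < t)
    (hA : ∀ b, g b ≤ t → (fun i => entryValue (q i) (b i)) ∈ A)
    (hE : ∑ b : Fin n → Bool, (∏ j, entryWeight (q j) (b j)) * g b ≤ δ * t) :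
    1 - δ ≤ (diagLaw q).real A := by
  classical
  have := fun i => isProbabilityMeasure_bernoulliLaw (h0 i) (h1 i)
  set μ := Measure.pi fun i => bernoulliLaw (q i) with hμ
  set f : (Fin n → Bool) → (Fin n → ℝ) := fun b i => entryValue (q i) (b i) with hf
  have hm (i : Fin n) : Measurable (entryValue (q i)) := measurable_of_finite _
  have hfm : Measurable f := measurable_of_finite _
  have hlaw : diagLaw q = μ.map f := by
    have hp (i : Fin n) : IsProbabilityMeasure ((bernoulliLaw (q i)).map (entryValue (q i))) :=
      Measure.isProbabilityMeasure_map (hm i).aemeasurable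
    rw [hμ, hf, Measure.pi_map_pi fun i => (hm i).aemeasurable]
    simp only [map_bernoulliLaw]
    rfl
  have : IsProbabilityMeasure (diagLaw q) :=
    hlaw ▸ Measure.isProbabilityMeasure_map hfm.aemeasurable
  have hsing (b : Fin n → Bool) : μ.real {b} = ∏ j, entryWeight (q j) (b j) := by
    rw [Measure.real, hμ, Measure.pi_singleton, ENNReal.toReal_prod]
    exact Finset.prod_congr rfl fun i _ => bernoulliLaw_real_singleton (h0 i) (h1 i) (b i)
  have hW (b : Fin n → Bool) : 0 ≤ ∏ j, entryWeight (q j) (b j) := by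
    rw [← hsing]; exact measureReal_nonneg
  have hmarkov : μ.real {b | t < g b} * t ≤ δ * t := by
    refine le_trans ?_ hE
    have : {b | t < g b} = ((univ.filter fun b => t < g b : Finset (Fin n → Bool)) : Set _) := by
      ext; simp
    rw [this, ← sum_measureReal_singleton, Finset.sum_mul]
    refine (Finset.sum_le_sum fun b hb => ?_).trans
      (Finset.sum_le_sum_of_subset_of_nonneg (Finset.filter_subset _ _)
        fun b _ _ => mul_nonneg (hW b) (hg b))
    rw [hsing]
    exact mul_le_mul_of_nonneg_left (by simpa using (mem_filter.1 hb).2.le) (hW b)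
  have hcompl : μ.real {b | g b ≤ t} = 1 - μ.real {b | t < g b} := by
    rw [← probReal_compl_eq_one_sub (MeasurableSet.of_discrete)]
    congr 1; ext; simp
  have hle : μ.real {b | g b ≤ t} ≤ (diagLaw q).real A := by
    refine (measureReal_mono (fun b hb => hA b hb : {b | g b ≤ t} ⊆ f ⁻¹' A)).trans ?_
    refine ENNReal.toReal_mono (measure_ne_top _ _) ?_
    rw [hlaw]
    -- This direction holds for every set, so `A` need not be measurable.
    exact Measure.le_map_apply hfm.aemeasurable A
  have := le_of_mul_le_mul_right hmarkov ht
  linarith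

end Law

/-! ### From the quadratic form bound to the embedding. -/

section Embedding

variable {n d ρ : ℕ} {X : Matrix (Fin n) (Fin d) ℝ} {U : Matrix (Fin n) (Fin ρ) ℝ}

theorem norm_toLp_sq_eq_dotProduct {m : ℕ} (x : Fin m → ℝ) :
    ‖WithLp.toLp 2 x‖ ^ 2 = x ⬝ᵥ x := by
  rw [EuclideanSpace.real_norm_sq_eq]
  simp [dotProduct, sq]

theorem IsOrthonormalColBasis.sum_vecMulVec_row (h : IsOrthonormalColBasis X U) :
    ∑ i, vecMulVec (U.row i) (U.row i) = 1 := by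
  ext j j'
  have := (orthonormal_iff_ite.1 h.1) j j'
  simp only [PiLp.inner_apply, Matrix.col_apply] at this
  rw [Matrix.sum_apply, Matrix.one_apply, ← this]
  simp [vecMulVec_apply, mul_comm]

theorem IsOrthonormalColBasis.sum_norm_row_sq (h : IsOrthonormalColBasis X U) :
    ∑ i, ‖WithLp.toLp 2 (U.row i)‖ ^ 2 = ρ := by
  have := congrArg Matrix.trace h.sum_vecMulVec_row
  rw [Matrix.trace_sum, Matrix.trace_one, Fintype.card_fin] at this
  rw [← this]
  exact Finset.sum_congr rfl fun i _ => by
    rw [norm_toLp_sq_eq_dotProduct, Matrix.trace_vecMulVec]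

theorem IsOrthonormalColBasis.exists_mulVec_eq (h : IsOrthonormalColBasis X U)
    (γ : Fin d → ℝ) : ∃ v, U *ᵥ v = X *ᵥ γ := by
  have : X *ᵥ γ ∈ LinearMap.range U.mulVecLin := by
    rw [Matrix.range_mulVecLin, h.2, ← Matrix.range_mulVecLin]
    exact ⟨γ, rfl⟩
  exact this

theorem isSubspaceEmbedding_of_abs_le (h : IsOrthonormalColBasis X U) {ε : ℝ} {s : Fin n → ℝ}
    (hs : ∀ v : Fin ρ → ℝ, |v ⬝ᵥ ((∑ i, (s i ^ 2 - 1) • vecMulVec (U.row i) (U.row i)) *ᵥ v)| ≤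
      ε * (v ⬝ᵥ v)) :
    IsSubspaceEmbedding ε X (Matrix.diagonal s) := by
  intro γ
  obtain ⟨v, hv⟩ := h.exists_mulVec_eq γ
  have hquad (a : Fin n → ℝ) :
      v ⬝ᵥ ((∑ i, a i • vecMulVec (U.row i) (U.row i)) *ᵥ v) = ∑ i, a i * (U *ᵥ v) i ^ 2 := by
    rw [Matrix.sum_mulVec, dotProduct_sum]
    refine Finset.sum_congr rfl fun i _ => ?_
    rw [Matrix.smul_mulVec, Matrix.vecMulVec_mulVec, dotProduct_smul, op_smul_eq_smul,
      dotProduct_smul, dotProduct_comm v]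
    simp only [smul_eq_mul, Matrix.mulVec, Matrix.row]
    ring
  have h1 : v ⬝ᵥ v = ∑ i, (U *ᵥ v) i ^ 2 := by
    have := hquad fun _ => 1
    simpa [h.sum_vecMulVec_row] using this
  have hX : ‖WithLp.toLp 2 (X *ᵥ γ)‖ ^ 2 = v ⬝ᵥ v := by
    rw [← hv, norm_toLp_sq_eq_dotProduct, h1]
    simp [dotProduct, sq]
  have hSX : ‖WithLp.toLp 2 ((Matrix.diagonal s * X) *ᵥ γ)‖ ^ 2 =
      v ⬝ᵥ v + ∑ i, (s i ^ 2 - 1) * (U *ᵥ v) i ^ 2 := by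
    rw [← Matrix.mulVec_mulVec, ← hv, norm_toLp_sq_eq_dotProduct, h1, ← Finset.sum_add_distrib]
    simp only [dotProduct, Matrix.mulVec_diagonal]
    exact Finset.sum_congr rfl fun i _ => by ring
  have := abs_le.1 (hs v)
  rw [hquad] at this
  rw [hX, hSX]
  constructor <;> linarith [this.1, this.2]

theorem leverageScore_nonneg (U : Matrix (Fin n) (Fin ρ) ℝ) (i : Fin n) :
    0 ≤ leverageScore U i := by
  unfold leverageScore; positivity

theorem entryWeight_mean {q : ℝ} (hq : q ≠ 0) (h0 : 0 ≤ q) :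
    ∑ x, entryWeight q x * (entryValue q x ^ 2 - 1) = 0 := by
  simp [entryWeight, entryValue, Real.sq_sqrt h0]
  field_simp
  ring

/-- For `q = 1` the only outcome with positive weight is `true`, and the variance term vanishes. For
`y = q * τ`, the outcome `false` has coefficient `-1` and gives equality, which is why the shift is
`2`. -/
theorem entryWeight_variance_le {q : ℝ} (hq : 0 < q) (hq1 : q ≤ 1) (x : Bool)
    (hx : 0 < entryWeight q x) {y τ : ℝ} (hτ : 0 ≤ τ) (hy : q = 1 ∨ y = q * τ) :
    (∑ c, entryWeight q c *
      ((entryValue q x ^ 2 - 1) - (entryValue q c ^ 2 - 1)) ^ 2) * y ≤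
      τ * ((entryValue q x ^ 2 - 1) + 2) := by
  rcases hy with rfl | rfl
  · cases x
    · simp [entryWeight] at hx
    · simp [entryWeight, entryValue]; linarith
  · cases x
    · simp [entryWeight, entryValue, Real.sq_sqrt hq.le]
      field_simp
      linarith
    · simp [entryWeight, entryValue, Real.sq_sqrt hq.le]
      field_simp
      nlinarith

/-- A row with `q = 0` has a coefficient of mean `-1`, but the row itself vanishes; hence the mean
condition in the moment bounds is weighted by `u i`. -/
theorem samplingProb_eq_zero_or (h : IsOrthonormalColBasis X U) (hρ : 0 < ρ) {k : ℝ}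
    (hk : 0 < k) (i : Fin n) :
    (samplingProb U k i = 0 ∧ U.row i = 0) ∨ 0 < samplingProb U k i ∧
      (samplingProb U k i = 1 ∨ U.row i ⬝ᵥ U.row i = samplingProb U k i * (ρ / k)) := by
  have hρ' : (0 : ℝ) < ρ := by exact_mod_cast hρ
  have hl : k * leverageScore U i = k / ρ * (U.row i ⬝ᵥ U.row i) := by
    rw [leverageScore, h.sum_norm_row_sq, norm_toLp_sq_eq_dotProduct]; ring
  by_cases h0 : U.row i = 0
  · left
    refine ⟨?_, h0⟩
    rw [samplingProb, hl, h0]; simp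
  · right
    have hpos : 0 < U.row i ⬝ᵥ U.row i := by
      rw [← norm_toLp_sq_eq_dotProduct]
      have : WithLp.toLp 2 (U.row i) ≠ 0 := by simpa using h0
      positivity
    refine ⟨by rw [samplingProb, hl]; positivity, ?_⟩
    rw [samplingProb, hl]
    rcases le_total 1 (k / ρ * (U.row i ⬝ᵥ U.row i)) with h1 | h1
    · left; exact min_eq_left h1
    · right; rw [min_eq_right h1]; field_simp

/-- The moment bound for leverage score sampling. -/
theorem one_sub_le_diagLaw_samplingProb (h : IsOrthonormalColBasis X U) (hρ : 0 < ρ) {k ε δ : ℝ}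
    (hk : 0 < k) (hε : 0 < ε) {p : ℕ} (hp : p ≠ 0) (hpk : p * (ρ / k) ≤ 1)
    (hδ : (5 * p * (ρ / k)) ^ p * ρ ≤ δ * ε ^ (2 * p)) :
    1 - δ ≤ (diagLaw (samplingProb U k)).real
      {s : Fin n → ℝ | IsSubspaceEmbedding ε X (Matrix.diagonal s)} := by
  set q := samplingProb U k with hq
  have h0 (i : Fin n) : 0 ≤ q i := le_min zero_le_one (mul_nonneg hk.le (leverageScore_nonneg U i))
  have h1 (i : Fin n) : q i ≤ 1 := min_le_left _ _
  set a : Fin n → Bool → ℝ := fun i x => entryValue (q i) x ^ 2 - 1 with ha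
  refine one_sub_le_diagLaw_real h0 h1 (g := fun b => (rankOneSum a U.row b ^ (2 * p)).trace)
    (fun b => trace_even_pow_nonneg (rankOneSum_isSymm _ _ _) (even_two_mul p))
    (pow_pos hε (2 * p)) (fun b hb => ?_) (le_trans ?_ hδ)
  · exact isSubspaceEmbedding_of_abs_le h fun v =>
      abs_dotProduct_mulVec_le_of_trace_pow_le (rankOneSum_isSymm a U.row b) hp hε.le hb v
  · have hτ : (0 : ℝ) ≤ ρ / k := by positivity
    have := sum_prod_mul_trace_pow_le (w := fun i => entryWeight (q i)) (a := a) (u := U.row)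
      (fun i => entryWeight_nonneg (h0 i) (h1 i)) (fun i => sum_entryWeight (q i)) (fun i => ?_)
      h.sum_vecMulVec_row hτ (fun i x hx => ?_) p hpk le_rfl
    · simpa using this
    · rcases samplingProb_eq_zero_or h hρ hk i with hi | hi
      · rw [hi.2, smul_zero]
      · rw [entryWeight_mean hi.1.ne' hi.1.le, zero_smul]
    · rcases samplingProb_eq_zero_or h hρ hk i with hi | hi
      · have hv : -1 ≤ a i x := by simp only [ha]; nlinarith [sq_nonneg (entryValue (q i) x)]
        rw [hi.2, dotProduct_zero, mul_zero]
        exact mul_nonneg hτ (by linarith)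
      · exact entryWeight_variance_le hi.1 (h1 i) x hx hτ hi.2

end Embedding

end LeverageSampling

/-! ### Choice of the constants. -/

/-- For every failure probability `δ` there is a constant `D` such that leverage-score sampling
with size parameter `k ≥ D ρ log (ρ / ε) / ε ^ 2` gives an `ε`-subspace embedding with probability
at least `1 - δ`. Where `ρ = 1`, the accuracy `ε` has to stay below some `ε₀ < 1`, because
`log (ρ / ε)` tends to `0` as `ε` tends to `1`. -/
theorem mainTheorem3 (δ ε₀ : ℝ) (hδ : 0 < δ) (hδ1 : δ < 1) (hε₀ : 0 < ε₀) (hε₀1 : ε₀ < 1) :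
    ∃ D : ℝ, 0 < D ∧
      ∀ (n d ρ : ℕ) (X : Matrix (Fin n) (Fin d) ℝ) (U : Matrix (Fin n) (Fin ρ) ℝ) (ε k : ℝ),
        X.rank = ρ →
        LeverageSampling.IsOrthonormalColBasis X U →
        0 < ε → ε < 1 → (ρ = 1 → ε ≤ ε₀) →
        D * ((ρ : ℝ) * Real.log ((ρ : ℝ) / ε) / ε ^ 2) ≤ k →
        1 - δ ≤ (LeverageSampling.diagLaw (LeverageSampling.samplingProb U k)).real
          {s : Fin n → ℝ | LeverageSampling.IsSubspaceEmbedding ε X (Matrix.diagonal s)} := by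
  -- `L` is a lower bound for `log (ρ / ε)`, from `ρ ≥ 2` or from `ε ≤ ε₀`; `C` uses it to absorb
  -- the additive `log (1 / δ) + 1`.
  set L : ℝ := min (Real.log 2) (Real.log (1 / ε₀)) with hL
  have hLpos : 0 < L :=
    lt_min (Real.log_pos one_lt_two) (Real.log_pos ((one_lt_div hε₀).2 hε₀1))
  have hlδ : 0 < Real.log (1 / δ) := Real.log_pos ((one_lt_div hδ).2 hδ1)
  set C : ℝ := 1 + (Real.log (1 / δ) + 1) / L with hC
  have hCpos : 0 < C := by positivity
  refine ⟨15 * C, by positivity, fun n d ρ X U ε k _ hU hε hε1 hερ hk => ?_⟩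
  rcases Nat.eq_zero_or_pos ρ with rfl | hρ
  · have hk0 : 0 ≤ k := by simpa using hk
    refine LeverageSampling.one_sub_le_diagLaw_real (g := fun _ => 0) (t := 1)
      (fun i => le_min zero_le_one (mul_nonneg hk0 (LeverageSampling.leverageScore_nonneg U i)))
      (fun i => min_le_left _ _) (fun _ => le_rfl) one_pos (fun b _ γ => ?_) (by simpa using hδ.le)
    obtain ⟨v, hv⟩ := hU.exists_mulVec_eq γ
    have hX : X *ᵥ γ = 0 := by rw [← hv, Subsingleton.elim v 0, Matrix.mulVec_zero]
    simp [← Matrix.mulVec_mulVec, hX]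
  have hρ1 : (1 : ℝ) ≤ ρ := by exact_mod_cast hρ
  set Λ : ℝ := Real.log (ρ / ε) with hΛ
  have hlogρ : 0 ≤ Real.log ρ := Real.log_nonneg hρ1
  have hΛρ : Real.log ρ ≤ Λ :=
    Real.log_le_log (by linarith) ((le_div_iff₀ hε).2 (by nlinarith))
  have hΛL : L ≤ Λ := by
    rcases (Nat.succ_le_of_lt hρ).eq_or_lt with h1 | h2
    · have h1 : ρ = 1 := h1.symm
      refine (min_le_right _ _).trans (Real.log_le_log (by positivity) ?_)
      rw [h1, Nat.cast_one]
      exact one_div_le_one_div_of_le hε (hερ h1)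
    · have h2 : (2 : ℝ) ≤ ρ := by exact_mod_cast h2
      exact (min_le_left _ _).trans ((Real.log_le_log two_pos h2).trans hΛρ)
  have hΛpos : 0 < Λ := hLpos.trans_le hΛL
  have hlog : Real.log (ρ / δ) = Real.log ρ + Real.log (1 / δ) := by
    rw [Real.log_div (by linarith) hδ.ne', Real.log_div one_ne_zero hδ.ne', Real.log_one]; ring
  have hlogpos : 0 < Real.log (ρ / δ) := by linarith
  -- The constant `15` makes `5pρ/k ≤ ε²/3`, so the failure probability is at most `3^(-p) ρ`, and
  -- `3 > e` makes this at most `δ` for such `p`.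
  set p : ℕ := ⌈Real.log (ρ / δ)⌉₊ with hp
  have hp0 : p ≠ 0 := (Nat.ceil_pos.2 hlogpos).ne'
  have hp1 : (1 : ℝ) ≤ p := by exact_mod_cast Nat.one_le_iff_ne_zero.2 hp0
  have hpC : (p : ℝ) ≤ C * Λ := by
    have h1 : (p : ℝ) < Real.log (ρ / δ) + 1 := Nat.ceil_lt_add_one hlogpos.le
    have h2 : Real.log (1 / δ) + 1 ≤ (Real.log (1 / δ) + 1) / L * Λ := by
      rw [div_mul_eq_mul_div, le_div_iff₀ hLpos]
      exact mul_le_mul_of_nonneg_left hΛL (by linarith)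
    rw [hC, add_mul, one_mul]
    linarith
  have hkp : 15 * p * ρ / ε ^ 2 ≤ k := by
    refine le_trans ?_ hk
    have : 15 * C * (ρ * Λ / ε ^ 2) = 15 * (C * Λ) * ρ / ε ^ 2 := by ring
    rw [this]
    gcongr
  have hkpos : 0 < k := lt_of_lt_of_le (by positivity) hkp
  have hτ : 5 * p * (ρ / k) ≤ ε ^ 2 / 3 := by
    rw [div_le_iff₀ (by positivity)] at hkp
    rw [← mul_div_assoc, div_le_iff₀ hkpos]
    linarith
  refine LeverageSampling.one_sub_le_diagLaw_samplingProb hU hρ hkpos hε hp0 ?_ ?_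
  · nlinarith
  · have he : (1 / 3 : ℝ) ^ p ≤ δ / ρ := by
      have h1 : (1 / 3 : ℝ) ≤ Real.exp (-1) := by
        rw [Real.exp_neg, one_div]
        exact inv_anti₀ (Real.exp_pos 1) Real.exp_one_lt_three.le
      calc (1 / 3 : ℝ) ^ p ≤ Real.exp (-1) ^ p := by gcongr
        _ = Real.exp (-p) := by rw [← Real.exp_nat_mul]; congr 1; ring
        _ ≤ Real.exp (-Real.log (ρ / δ)) := by
          gcongr
          exact Nat.le_ceil _
        _ = δ / ρ := by rw [Real.exp_neg, Real.exp_log (by positivity), inv_div]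
    calc (5 * p * (ρ / k)) ^ p * ρ ≤ (ε ^ 2 / 3) ^ p * ρ := by gcongr
      _ = ε ^ (2 * p) * ((1 / 3 : ℝ) ^ p * ρ) := by
        rw [pow_mul, div_eq_mul_one_div, mul_pow]; ring
      _ ≤ ε ^ (2 * p) * (δ / ρ * ρ) := by gcongr
      _ = δ * ε ^ (2 * p) := by field_simp
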